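/- **Setting.** Let $\triangle$ be a t-norm on $[0,1]$, let $\mathcal R$ be a proximity relation on a set of symbols (a reflexive, symmetric fuzzy relation with values in $[0,1]$), and let $\lambda\in(0,1]$ be a cut value. Terms and atomic formulas are built from these symbols and a countably infinite set of variables. $\mathcal R$ extends to expressions by $\mathcal R(x,x)=1$ for variables, $\mathcal R(f(t_1,\dots,t_n),g(s_1,\dots,s_n))=\mathcal R(f,g)\triangle\mathcal R(t_1,s_1)\triangle\cdots\triangle\mathcal R(t_n,s_n)$, and $0$ for all other pairs. $\mathrm{wmgu}(A,B)$ denotes a substitution computed by the weak unification algorithm, which starts from the problem $A\approx B$ and the identity substitution and processes a sequence of problems from left to right: $f(t_1,\dots,t_n)\approx g(s_1,\dots,s_n)$ is replaced by $t_1\approx s_1,\dots,t_n\approx s_n$ if $\mathcal R(f,g)\ge\lambda$; $x\approx x$ is removed; $x\approx t$ or $t\approx x$ with $x$ not in $t$ is removed and $\{x/t\}$ is applied to the remaining problems and composed with the substitution (an equation between two variables may bind either one); otherwise the algorithm fails. A program $\Pi$ is a set of graded rules $\langle A\leftarrow Q;\delta\rangle$ with $\delta\in[0,1]$, $A$ atomic,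 and $Q$ a conjunction (possibly empty, written $\square$) of conjuncts; a conjunct is an atomic formula or an embedded implication $R\Rightarrow G$ with $R$ a graded rule and $G$ a conjunct (atomic, or again an embedded implication). Goals are conjunctions of the same kind. A state is a tuple (goal, program, substitution, degree). A rule is *standardised apart* if its variables have been renamed so that they occur neither in the goal nor in the substitution of the current state, nor in those of the states in which the enclosing subderivations were started. **HWSLD resolution** is the least relation $\to$ such that 1. if $\langle A\leftarrow Q;\delta\rangle$ is a standardised apart rule of $\Pi$, $\sigma=\mathrm{wmgu}(A,A')$, $\beta=\mathcal R(A\sigma,A'\sigma)\ge\lambda$ and $\delta\triangle\beta\triangle\alpha\ge\lambda$, then $\langle\leftarrow A'\wedge Q',\Pi,\theta,\alpha\rangle\to\langle\leftarrow(Q\wedge Q')\sigma,\Pi,\theta\sigma,\delta\triangle\beta\triangle\alpha\rangle$; 2. if $\langle\leftarrow G,\{R\}\cup\Pi,\mathrm{id},1\rangle\to^*\langle\square,\{R\}\cup\Pi,\sigma,\alpha'\rangle$, then $\langle\leftarrow(R\Rightarrow G)\wedge Q,\Pi,\theta,\alpha\rangle\to\langle\leftarrow Q\sigma,\Pi,\theta\sigma,\alpha\triangle\alpha'\rangle$.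 **Expansion.** The expansion of a rule $\langle p(t_1,\dots,t_n)\leftarrow Q;\delta\rangle$ consists, for each symbol $q$ with $\mathcal R(p,q)\ge\lambda$, of the rule $q(x_1,\dots,x_n)\leftarrow(\delta\triangle\mathcal R(p,q))\wedge x_1\approx t_1\wedge\dots\wedge x_n\approx t_n\wedge Q$, where $x_1,\dots,x_n$ are distinct variables not occurring in the given rule. The expanded program $\Pi'$ of $\Pi$ is the union of the expansions of its rules. **The operational semantics for expanded programs** is the least relation $\leadsto$ such that 1. if $\beta\in(0,1]$ and $\beta\triangle\alpha\ge\lambda$, then $\langle\leftarrow\beta\wedge Q',\Pi',\theta,\alpha\rangle\leadsto\langle\leftarrow Q',\Pi',\theta,\beta\triangle\alpha\rangle$; 2. if $\sigma=\mathrm{wmgu}(A,B)$, $\beta=\mathcal R(A\sigma,B\sigma)\ge\lambda$ and $\beta\triangle\alpha\ge\lambda$, then $\langle\leftarrow A\approx B\wedge Q',\Pi',\theta,\alpha\rangle\leadsto\langle\leftarrow Q'\sigma,\Pi',\theta\sigma,\beta\triangle\alpha\rangle$; 3. if $p(x_1,\dots,x_n)\leftarrow\beta\wedge x_1\approx t_1\wedge\dots\wedge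 x_n\approx t_n\wedge Q$ is a standardised apart rule of $\Pi'$, then $\langle\leftarrow p(s_1,\dots,s_n)\wedge Q',\Pi',\theta,\alpha\rangle\leadsto\langle\leftarrow\beta\wedge s_1\approx t_1\wedge\dots\wedge s_n\approx t_n\wedge Q\wedge Q',\Pi',\theta,\alpha\rangle$; 4. if $\langle\leftarrow G,\Pi'',\mathrm{id},1\rangle\leadsto^*\langle\square,\Pi'',\sigma,\beta\rangle$, where $\Pi''$ is the union of $\Pi'$ and the expansion of $R$, then $\langle\leftarrow(R\Rightarrow G)\wedge Q',\Pi',\theta,\alpha\rangle\leadsto\langle\leftarrow Q'\sigma,\Pi',\theta\sigma,\beta\triangle\alpha\rangle$. **Proposition.** Let $\Pi$ be a program and $\Pi'$ its expanded program. For all goals $Q,Q'$ (in the source syntax, without degrees and problems $\approx$), all substitutions $\theta,\theta'$, with $\theta$ of finite domain, and all degrees $\alpha,\alpha'$, there is an HWSLD derivation $\langle\leftarrow Q,\Pi,\theta,\alpha\rangle\to^*\langle\leftarrow Q',\Pi,\theta',\alpha'\rangle$ if and only if there is a derivation $\langle\leftarrow Q,\Pi',\theta,\alpha\rangle\leadsto^*\langle\leftarrow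 Q',\Pi',\theta',\alpha'\rangle$ in the semantics for expanded programs, with the same goal, substitution and degree. -/

import Mathlib

namespace BousiProlog

/-- The real unit interval `[0,1]`, in which all degrees live. -/
abbrev Deg : Type := unitInterval

/-- A triangular norm on `[0,1]`. -/
structure TNorm where
  op : Deg → Deg → Deg
  comm : ∀ a b, op a b = op b a
  assoc : ∀ a b c, op (op a b) c = op a (op b c)
  mono : ∀ a b c, a ≤ b → op a c ≤ op b c
  op_one : ∀ a, op a 1 = a

/-- A proximity relation on a set of symbols: a reflexive and symmetric binary fuzzy relation. -/
structure Proximity (Sym : Type*) where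
  rel : Sym → Sym → Deg
  refl : ∀ a, rel a a = 1
  symm : ∀ a b, rel a b = rel b a

/-! ### Terms and substitutions -/

/-- First-order terms. Variables are natural numbers. As in Prolog, a symbol may be applied to any
number of arguments; constants are symbols applied to no argument. -/
inductive Term (Sym : Type*) where
  | var (x : ℕ)
  | app (f : Sym) (args : List (Term Sym))

/-- Substitutions; finiteness of the domain is stated separately, by `Subst.FiniteDomain`. -/
abbrev Subst (Sym : Type*) := ℕ → Term Sym

section Terms

variable {Sym : Type*}

mutual
/-- The instance `tσ` of a term. -/
def Term.subst (σ : Subst Sym) : Term Sym → Term Sym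
  | .var x => σ x
  | .app f ts => .app f (Term.substList σ ts)
/-- The instance of a list of terms. -/
def Term.substList (σ : Subst Sym) : List (Term Sym) → List (Term Sym)
  | [] => []
  | t :: ts => Term.subst σ t :: Term.substList σ ts
end

mutual
/-- The variables of a term. -/
def Term.vars : Term Sym → Set ℕ
  | .var x => {x}
  | .app _ ts => Term.varsList ts
/-- The variables of a list of terms. -/
def Term.varsList : List (Term Sym) → Set ℕ
  | [] => ∅
  | t :: ts => Term.vars t ∪ Term.varsList ts
end

/-- The identity (empty) substitution. -/
def Subst.id : Subst Sym := fun x => .var x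

/-- The composition `θσ`: first `θ`, then `σ`. -/
def Subst.comp (θ σ : Subst Sym) : Subst Sym := fun x => (θ x).subst σ

/-- The substitution `{x/t}`. -/
def Subst.single (x : ℕ) (t : Term Sym) : Subst Sym := fun y => if y = x then t else .var y

/-- The variables that a substitution moves. -/
def Subst.dom (θ : Subst Sym) : Set ℕ := {x | θ x ≠ .var x}

/-- All the variables that occur in a substitution. -/
def Subst.vars (θ : Subst Sym) : Set ℕ := θ.dom ∪ {y | ∃ x ∈ θ.dom, y ∈ (θ x).vars}

/-- The substitution moves finitely many variables only. -/
def Subst.FiniteDomain (θ : Subst Sym) : Prop := θ.dom.Finite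

/-- A renaming, seen as a substitution. -/
def Subst.ofPerm (ρ : Equiv.Perm ℕ) : Subst Sym := fun x => .var (ρ x)

mutual
/-- The extension of a proximity relation from symbols to expressions: the degrees of the pairs of
symbols at corresponding positions are compounded by the t-norm. Two expressions of different shape
have degree `0`. -/
noncomputable def Term.degree (T : TNorm) (R : Proximity Sym) : Term Sym → Term Sym → Deg
  | .var x, .var y => if x = y then 1 else 0
  | .app f ts, .app g ss => T.op (R.rel f g) (Term.degreeList T R ts ss)
  | _, _ => 0
/-- The compound degree of two lists of expressions, `0` if the lengths differ. -/
noncomputable def Term.degreeList (T : TNorm) (R : Proximity Sym) :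
    List (Term Sym) → List (Term Sym) → Deg
  | [], [] => 1
  | t :: ts, s :: ss => T.op (Term.degree T R t s) (Term.degreeList T R ts ss)
  | _, _ => 0
end

/-! ### Weak unification -/

/-- The proximity-based unification relation, on pairs of a sequence of unification problems
`E ≈ E'` still to be solved and the substitution computed so far. The problems are processed from
left to right; an equation is not oriented, so an equation between two variables may bind either. -/
inductive UnifStep (R : Proximity Sym) (lam : Deg) :
    List (Term Sym × Term Sym) × Subst Sym → List (Term Sym × Term Sym) × Subst Sym → Prop
  | decompose (f g : Sym) (ts ss : List (Term Sym)) (E : List (Term Sym × Term Sym))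
      (θ : Subst Sym) (hlen : ts.length = ss.length) (hR : lam ≤ R.rel f g) :
      UnifStep R lam ((.app f ts, .app g ss) :: E, θ) (ts.zip ss ++ E, θ)
  | trivial (x : ℕ) (E : List (Term Sym × Term Sym)) (θ : Subst Sym) :
      UnifStep R lam ((.var x, .var x) :: E, θ) (E, θ)
  | elimLeft (x : ℕ) (t : Term Sym) (E : List (Term Sym × Term Sym)) (θ : Subst Sym)
      (hx : x ∉ t.vars) :
      UnifStep R lam ((.var x, t) :: E, θ)
        (E.map fun e => (e.1.subst (.single x t), e.2.subst (.single x t)),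
          θ.comp (.single x t))
  | elimRight (x : ℕ) (t : Term Sym) (E : List (Term Sym × Term Sym)) (θ : Subst Sym)
      (hx : x ∉ t.vars) :
      UnifStep R lam ((t, .var x) :: E, θ)
        (E.map fun e => (e.1.subst (.single x t), e.2.subst (.single x t)),
          θ.comp (.single x t))

/-- `σ` is a weak most general unifier `wmgu(A, B)` computed by the weak unification algorithm. The
algorithm fails iff there is no such `σ`. -/
def IsWmgu (R : Proximity Sym) (lam : Deg) (A B : Term Sym) (σ : Subst Sym) : Prop :=
  Relation.ReflTransGen (UnifStep R lam) ([(A, B)], Subst.id) ([], σ)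

end Terms

/-! ### Atoms, goals, rules, programs -/

/-- An atomic formula `p(t₁,…,tₙ)`. -/
structure Atom (Sym : Type*) where
  pred : Sym
  args : List (Term Sym)

/-- A conjunct of a goal or of a rule body: an atomic formula, or an embedded implication
`⟨head ← body; grade⟩ ⇒ concl`, whose consequent is an atomic formula or, for nested
implications, again an embedded implication. -/
inductive Lit (Sym : Type*) where
  | atom (A : Atom Sym)
  | imp (head : Atom Sym) (body : List (Lit Sym)) (grade : Deg) (concl : Lit Sym)

/-- A graded rule `⟨head ← body; grade⟩`. A fact is a rule with empty body. -/
structure Rule (Sym : Type*) where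
  head : Atom Sym
  body : List (Lit Sym)
  grade : Deg

/-- A program is a set of graded rules. -/
abbrev Program (Sym : Type*) := Set (Rule Sym)

section Formulas

variable {Sym : Type*}

/-- An atomic formula as an expression, to be unified and compared with other ones. -/
def Atom.toTerm (A : Atom Sym) : Term Sym := .app A.pred A.args

def Atom.subst (σ : Subst Sym) (A : Atom Sym) : Atom Sym := ⟨A.pred, Term.substList σ A.args⟩

def Atom.vars (A : Atom Sym) : Set ℕ := Term.varsList A.args

mutual
/-- The instance of a conjunct. All variables of an embedded implication are free. -/
def Lit.subst (σ : Subst Sym) : Lit Sym → Lit Sym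
  | .atom A => .atom (A.subst σ)
  | .imp H B δ G => .imp (H.subst σ) (Lit.substList σ B) δ (Lit.subst σ G)
/-- The instance of a conjunction. -/
def Lit.substList (σ : Subst Sym) : List (Lit Sym) → List (Lit Sym)
  | [] => []
  | L :: Ls => Lit.subst σ L :: Lit.substList σ Ls
end

mutual
/-- The variables of a conjunct. -/
def Lit.vars : Lit Sym → Set ℕ
  | .atom A => A.vars
  | .imp H B _ G => H.vars ∪ Lit.varsList B ∪ Lit.vars G
/-- The variables of a conjunction. -/
def Lit.varsList : List (Lit Sym) → Set ℕ
  | [] => ∅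
  | L :: Ls => Lit.vars L ∪ Lit.varsList Ls
end

def Rule.vars (r : Rule Sym) : Set ℕ := r.head.vars ∪ Lit.varsList r.body

/-- The variant of a rule under a renaming of the variables. -/
def Rule.rename (ρ : Equiv.Perm ℕ) (r : Rule Sym) : Rule Sym :=
  ⟨r.head.subst (.ofPerm ρ), Lit.substList (.ofPerm ρ) r.body, r.grade⟩

end Formulas

/-! ### Hypothetical weak SLD resolution -/

/-- A state of a computation: goal, program, substitution, approximation degree. -/
structure State (Goal Prog Sym : Type*) where
  goal : Goal
  prog : Prog
  subst : Subst Sym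
  degree : Deg

/-- Goals are conjunctions; the empty one is the empty clause `□`. -/
abbrev HState (Sym : Type*) := State (List (Lit Sym)) (Program Sym) Sym

section HWSLD

variable {Sym : Type*}

/-- The variables of the goal and of the substitution of a state. -/
def HState.vars (s : HState Sym) : Set ℕ := Lit.varsList s.goal ∪ s.subst.vars

mutual
/-- One step of HWSLD resolution. The set `W` contains the variables which are in use outside of the
present derivation: standardised apart rules avoid the variables in `W` and those of the state. -/
inductive HStep (T : TNorm) (R : Proximity Sym) (lam : Deg) :
    Set ℕ → HState Sym → HState Sym → Prop
  | resolve (W : Set ℕ) (P : Program Sym) (r : Rule Sym) (ρ : Equiv.Perm ℕ) (A : Atom Sym)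
      (Q : List (Lit Sym)) (θ σ : Subst Sym) (α β : Deg)
      (hr : r ∈ P)
      (hfresh : Disjoint (r.rename ρ).vars (W ∪ HState.vars ⟨.atom A :: Q, P, θ, α⟩))
      (hσ : IsWmgu R lam (r.rename ρ).head.toTerm A.toTerm σ)
      (hβ : β = Term.degree T R ((r.rename ρ).head.toTerm.subst σ) (A.toTerm.subst σ))
      (hlamβ : lam ≤ β)
      (hlam : lam ≤ T.op (T.op r.grade β) α) :
      HStep T R lam W ⟨.atom A :: Q, P, θ, α⟩
        ⟨Lit.substList σ ((r.rename ρ).body ++ Q), P, θ.comp σ, T.op (T.op r.grade β) α⟩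
  | assume (W : Set ℕ) (P : Program Sym) (H : Atom Sym) (B : List (Lit Sym)) (δ : Deg)
      (G : Lit Sym) (Q : List (Lit Sym)) (θ σ : Subst Sym) (α α' : Deg)
      (hsub : HSteps T R lam (W ∪ HState.vars ⟨.imp H B δ G :: Q, P, θ, α⟩)
        ⟨[G], insert ⟨H, B, δ⟩ P, Subst.id, 1⟩ ⟨[], insert ⟨H, B, δ⟩ P, σ, α'⟩) :
      HStep T R lam W ⟨.imp H B δ G :: Q, P, θ, α⟩
        ⟨Lit.substList σ Q, P, θ.comp σ, T.op α α'⟩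
/-- The reflexive and transitive closure of `HStep`: derivations. -/
inductive HSteps (T : TNorm) (R : Proximity Sym) (lam : Deg) :
    Set ℕ → HState Sym → HState Sym → Prop
  | refl (W : Set ℕ) (s : HState Sym) : HSteps T R lam W s s
  | head (W : Set ℕ) (s₁ s₂ s₃ : HState Sym) (h : HStep T R lam W s₁ s₂)
      (hs : HSteps T R lam W s₂ s₃) : HSteps T R lam W s₁ s₃
end

end HWSLD

/-! ### Expanded programs and their operational semantics -/

/-- An expanded rule `pred(x₁,…,xₙ) ← grade ∧ x₁ ≈ t₁ ∧ … ∧ xₙ ≈ tₙ ∧ body`, where `xs` is the list of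
the head variables and `ts` the list of the terms on the right-hand sides. -/
structure ExpRule (Sym : Type*) where
  pred : Sym
  xs : List ℕ
  grade : Deg
  ts : List (Term Sym)
  body : List (Lit Sym)

/-- A conjunct of a goal of the expanded semantics: a degree, a weak unification problem `A ≈ B`, or
a conjunct of a source goal. -/
inductive ExpLit (Sym : Type*) where
  | deg (β : Deg)
  | weq (A B : Term Sym)
  | lit (L : Lit Sym)

abbrev ExpProgram (Sym : Type*) := Set (ExpRule Sym)

abbrev ExpState (Sym : Type*) := State (List (ExpLit Sym)) (ExpProgram Sym) Sym

section Expanded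

variable {Sym : Type*}

def ExpRule.vars (c : ExpRule Sym) : Set ℕ :=
  {x | x ∈ c.xs} ∪ Term.varsList c.ts ∪ Lit.varsList c.body

/-- The variant of an expanded rule under a renaming of the variables. -/
def ExpRule.rename (ρ : Equiv.Perm ℕ) (c : ExpRule Sym) : ExpRule Sym :=
  ⟨c.pred, c.xs.map ρ, c.grade, Term.substList (.ofPerm ρ) c.ts,
    Lit.substList (.ofPerm ρ) c.body⟩

/-- The expansion of a rule `⟨p(t₁,…,tₙ) ← Q; δ⟩`: for each symbol `q` with `R(p,q) ≥ λ` the rule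
`q(x₁,…,xₙ) ← (δ △ R(p,q)) ∧ x₁ ≈ t₁ ∧ … ∧ xₙ ≈ tₙ ∧ Q`, where the `xᵢ` are distinct variables that
do not occur in the given rule. All choices of the `xᵢ` are included, they give variants. -/
def Rule.expand (T : TNorm) (R : Proximity Sym) (lam : Deg) (r : Rule Sym) : ExpProgram Sym :=
  {c | ∃ (q : Sym) (xs : List ℕ), lam ≤ R.rel r.head.pred q ∧ xs.length = r.head.args.length ∧
    xs.Nodup ∧ (∀ x ∈ xs, x ∉ r.vars) ∧
    c = ⟨q, xs, T.op r.grade (R.rel r.head.pred q), r.head.args, r.body⟩}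

/-- The expanded program. -/
def Program.expand (T : TNorm) (R : Proximity Sym) (lam : Deg) (P : Program Sym) :
    ExpProgram Sym :=
  ⋃ r ∈ P, r.expand T R lam

def ExpLit.subst (σ : Subst Sym) : ExpLit Sym → ExpLit Sym
  | .deg β => .deg β
  | .weq A B => .weq (A.subst σ) (B.subst σ)
  | .lit L => .lit (L.subst σ)

def ExpLit.vars : ExpLit Sym → Set ℕ
  | .deg _ => ∅
  | .weq A B => A.vars ∪ B.vars
  | .lit L => L.vars

/-- The variables of the goal and of the substitution of a state. -/
def ExpState.vars (s : ExpState Sym) : Set ℕ := {x | ∃ L ∈ s.goal, x ∈ L.vars} ∪ s.subst.vars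

mutual
/-- One step of the operational semantics for expanded programs; the set `W` has the same role as in
`HStep`. -/
inductive ExpStep (T : TNorm) (R : Proximity Sym) (lam : Deg) :
    Set ℕ → ExpState Sym → ExpState Sym → Prop
  | degree (W : Set ℕ) (P : ExpProgram Sym) (Q : List (ExpLit Sym)) (θ : Subst Sym) (α β : Deg)
      (hβ : 0 < β) (hlam : lam ≤ T.op β α) :
      ExpStep T R lam W ⟨.deg β :: Q, P, θ, α⟩ ⟨Q, P, θ, T.op β α⟩
  | unify (W : Set ℕ) (P : ExpProgram Sym) (A B : Term Sym) (Q : List (ExpLit Sym))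
      (θ σ : Subst Sym) (α β : Deg)
      (hσ : IsWmgu R lam A B σ)
      (hβ : β = Term.degree T R (A.subst σ) (B.subst σ))
      (hlamβ : lam ≤ β)
      (hlam : lam ≤ T.op β α) :
      ExpStep T R lam W ⟨.weq A B :: Q, P, θ, α⟩
        ⟨Q.map (ExpLit.subst σ), P, θ.comp σ, T.op β α⟩
  | unfold (W : Set ℕ) (P : ExpProgram Sym) (c : ExpRule Sym) (ρ : Equiv.Perm ℕ)
      (ss : List (Term Sym)) (Q : List (ExpLit Sym)) (θ : Subst Sym) (α : Deg)
      (hc : c ∈ P) (hlen : (c.rename ρ).xs.length = ss.length)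
      (hfresh : Disjoint (c.rename ρ).vars
        (W ∪ ExpState.vars ⟨.lit (.atom ⟨c.pred, ss⟩) :: Q, P, θ, α⟩)) :
      ExpStep T R lam W ⟨.lit (.atom ⟨c.pred, ss⟩) :: Q, P, θ, α⟩
        ⟨.deg c.grade :: (List.zipWith ExpLit.weq ss (c.rename ρ).ts ++
          ((c.rename ρ).body.map ExpLit.lit ++ Q)), P, θ, α⟩
  | assume (W : Set ℕ) (P : ExpProgram Sym) (H : Atom Sym) (B : List (Lit Sym)) (δ : Deg)
      (G : Lit Sym) (Q : List (ExpLit Sym)) (θ σ : Subst Sym) (α β : Deg)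
      (hsub : ExpSteps T R lam (W ∪ ExpState.vars ⟨.lit (.imp H B δ G) :: Q, P, θ, α⟩)
        ⟨[.lit G], Rule.expand T R lam ⟨H, B, δ⟩ ∪ P, Subst.id, 1⟩
        ⟨[], Rule.expand T R lam ⟨H, B, δ⟩ ∪ P, σ, β⟩) :
      ExpStep T R lam W ⟨.lit (.imp H B δ G) :: Q, P, θ, α⟩
        ⟨Q.map (ExpLit.subst σ), P, θ.comp σ, T.op β α⟩
/-- The reflexive and transitive closure of `ExpStep`: derivations. -/
inductive ExpSteps (T : TNorm) (R : Proximity Sym) (lam : Deg) :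
    Set ℕ → ExpState Sym → ExpState Sym → Prop
  | refl (W : Set ℕ) (s : ExpState Sym) : ExpSteps T R lam W s s
  | head (W : Set ℕ) (s₁ s₂ s₃ : ExpState Sym) (h : ExpStep T R lam W s₁ s₂)
      (hs : ExpSteps T R lam W s₂ s₃) : ExpSteps T R lam W s₁ s₃
end

end Expanded

end BousiProlog

namespace BousiProlog

variable {Sym : Type*}

-- One HWSLD resolution step of `q(s₁,…,sₙ)` with a rule for `p(t₁,…,tₙ)` corresponds to a block of
-- expanded steps: unfold with the rule for `q`, consume the degree `δ △ R(p,q)`, then solve `s₁ ≈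
-- t₁, …, sₙ ≈ tₙ` one by one. Computing the wmgu of head and atom begins by decomposing them into
-- their argument problems, and solving a sequence of problems amounts to solving each of its
-- segments in turn and composing the answers (`Solves.append`, `Solves.exists_of_append`). Since
-- equations are unoriented and `R` is symmetric, `sᵢ ≈ tᵢ` and `tᵢ ≈ sᵢ` have the same solutions.
-- The substitutions therefore agree exactly, not just up to renaming.
--
-- For the degrees, the expanded semantics measures each problem under the substitution computed up
-- to that point, HWSLD only under the complete wmgu. `Solves.degree_subst` shows that this makes no
-- difference. As a t-norm only decreases degrees, the threshold at the end of a block implies all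
-- thresholds inside it.
--
-- From left to right, each step is replaced by its block (`HSteps.expand`); finiteness of the
-- variables in use provides fresh head variables `xᵢ`. From right to left, a derivation ending in a
-- source goal cannot stop inside a block, so its steps group into blocks
-- (`ExpSteps.exists_solves`). Embedded implications are handled by simultaneous induction, since
-- expansion commutes with adding a rule.

/-! ### Substitutions -/

theorem Term.substList_eq_map (σ : Subst Sym) (ts : List (Term Sym)) :
    Term.substList σ ts = ts.map (Term.subst σ) := by
  induction ts with
  | nil => rfl
  | cons t ts ih => simp [Term.substList, ih]

theorem Lit.substList_eq_map (σ : Subst Sym) (Ls : List (Lit Sym)) :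
    Lit.substList σ Ls = Ls.map (Lit.subst σ) := by
  induction Ls with
  | nil => rfl
  | cons L Ls ih => simp [Lit.substList, ih]

mutual
theorem Term.subst_id : ∀ t : Term Sym, t.subst Subst.id = t
  | .var _ => rfl
  | .app f ts => by rw [Term.subst, Term.substList_id ts]
theorem Term.substList_id : ∀ ts : List (Term Sym), Term.substList Subst.id ts = ts
  | [] => rfl
  | t :: ts => by rw [Term.substList, Term.subst_id t, Term.substList_id ts]
end

mutual
theorem Term.subst_comp (σ τ : Subst Sym) :
    ∀ t : Term Sym, t.subst (σ.comp τ) = (t.subst σ).subst τ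
  | .var _ => rfl
  | .app f ts => by simp only [Term.subst, Term.substList_comp σ τ ts]
theorem Term.substList_comp (σ τ : Subst Sym) :
    ∀ ts : List (Term Sym),
      Term.substList (σ.comp τ) ts = Term.substList τ (Term.substList σ ts)
  | [] => rfl
  | t :: ts => by simp only [Term.substList, Term.subst_comp σ τ t, Term.substList_comp σ τ ts]
end

mutual
theorem Term.subst_single_of_notMem (x : ℕ) (s : Term Sym) :
    ∀ t : Term Sym, x ∉ t.vars → t.subst (Subst.single x s) = t
  | .var y, h => by
    have : y ≠ x := fun e => h (by simp [Term.vars, e])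
    simp [Term.subst, Subst.single, this]
  | .app f ts, h => by
    rw [Term.subst, Term.substList_single_of_notMem x s ts (by simpa [Term.vars] using h)]
theorem Term.substList_single_of_notMem (x : ℕ) (s : Term Sym) :
    ∀ ts : List (Term Sym), x ∉ Term.varsList ts → Term.substList (Subst.single x s) ts = ts
  | [], _ => rfl
  | t :: ts, h => by
    simp only [Term.varsList, Set.mem_union, not_or] at h
    rw [Term.substList, Term.subst_single_of_notMem x s t h.1,
      Term.substList_single_of_notMem x s ts h.2]
end

theorem Term.subst_var_single (x : ℕ) (t : Term Sym) :
    (Term.var x).subst (Subst.single x t) = t := by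
  simp [Term.subst, Subst.single]

theorem Subst.comp_id (σ : Subst Sym) : σ.comp Subst.id = σ :=
  funext fun _ => Term.subst_id _

theorem Subst.comp_assoc (ρ σ τ : Subst Sym) : (ρ.comp σ).comp τ = ρ.comp (σ.comp τ) :=
  funext fun _ => (Term.subst_comp _ _ _).symm

theorem Atom.subst_id (A : Atom Sym) : A.subst Subst.id = A := by
  cases A; simp [Atom.subst, Term.substList_id]

theorem Atom.subst_comp (σ τ : Subst Sym) (A : Atom Sym) :
    A.subst (σ.comp τ) = (A.subst σ).subst τ := by
  simp [Atom.subst, Term.substList_comp]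

mutual
theorem Lit.subst_id : ∀ L : Lit Sym, L.subst Subst.id = L
  | .atom A => by rw [Lit.subst, Atom.subst_id]
  | .imp H B δ G => by rw [Lit.subst, Atom.subst_id, Lit.substList_id B, Lit.subst_id G]
theorem Lit.substList_id : ∀ Ls : List (Lit Sym), Lit.substList Subst.id Ls = Ls
  | [] => rfl
  | L :: Ls => by rw [Lit.substList, Lit.subst_id L, Lit.substList_id Ls]
end

mutual
theorem Lit.subst_comp (σ τ : Subst Sym) :
    ∀ L : Lit Sym, L.subst (σ.comp τ) = (L.subst σ).subst τ
  | .atom A => by simp only [Lit.subst, Atom.subst_comp]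
  | .imp H B δ G => by
    simp only [Lit.subst, Atom.subst_comp, Lit.substList_comp σ τ B, Lit.subst_comp σ τ G]
theorem Lit.substList_comp (σ τ : Subst Sym) :
    ∀ Ls : List (Lit Sym), Lit.substList (σ.comp τ) Ls = Lit.substList τ (Lit.substList σ Ls)
  | [] => rfl
  | L :: Ls => by simp only [Lit.substList, Lit.subst_comp σ τ L, Lit.substList_comp σ τ Ls]
end

theorem map_lit_subst (σ : Subst Sym) (Q : List (Lit Sym)) :
    (Q.map ExpLit.lit).map (ExpLit.subst σ) = (Lit.substList σ Q).map ExpLit.lit := by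
  simp [Lit.substList_eq_map, ExpLit.subst]

/-! ### Finiteness of the sets of variables -/

mutual
theorem Term.vars_finite : ∀ t : Term Sym, t.vars.Finite
  | .var x => Set.finite_singleton x
  | .app _ ts => Term.varsList_finite ts
theorem Term.varsList_finite : ∀ ts : List (Term Sym), (Term.varsList ts).Finite
  | [] => Set.finite_empty
  | t :: ts => (Term.vars_finite t).union (Term.varsList_finite ts)
end

mutual
theorem Lit.vars_finite : ∀ L : Lit Sym, L.vars.Finite
  | .atom A => Term.varsList_finite A.args
  | .imp H B _ G =>
    ((Term.varsList_finite H.args).union (Lit.varsList_finite B)).union (Lit.vars_finite G)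
theorem Lit.varsList_finite : ∀ Ls : List (Lit Sym), (Lit.varsList Ls).Finite
  | [] => Set.finite_empty
  | L :: Ls => (Lit.vars_finite L).union (Lit.varsList_finite Ls)
end

theorem Rule.vars_finite (r : Rule Sym) : r.vars.Finite :=
  (Term.varsList_finite _).union (Lit.varsList_finite _)

theorem Subst.FiniteDomain.vars_finite {θ : Subst Sym} (h : θ.FiniteDomain) : θ.vars.Finite := by
  refine Set.Finite.union h ?_
  have : {y | ∃ x ∈ θ.dom, y ∈ (θ x).vars} = ⋃ x ∈ θ.dom, (θ x).vars := by ext; simp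
  rw [this]
  exact Set.Finite.biUnion h fun x _ => Term.vars_finite _

theorem Subst.finiteDomain_id : (Subst.id : Subst Sym).FiniteDomain := by
  simp [Subst.FiniteDomain, Subst.dom, Subst.id]

theorem Subst.finiteDomain_single (x : ℕ) (t : Term Sym) : (Subst.single x t).FiniteDomain := by
  refine (Set.finite_singleton x).subset fun y hy => ?_
  by_contra h
  exact hy (if_neg h)

theorem Subst.FiniteDomain.comp {θ σ : Subst Sym} (hθ : θ.FiniteDomain) (hσ : σ.FiniteDomain) :
    (θ.comp σ).FiniteDomain := by
  refine (Set.Finite.union hθ hσ).subset fun x hx => ?_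
  by_contra h
  simp only [Set.mem_union, Subst.dom, Set.mem_ofPred_eq, not_or, not_not] at h
  exact hx (by rw [Subst.comp, h.1, Term.subst, h.2])

theorem HState.vars_finite (s : HState Sym) (h : s.subst.FiniteDomain) : s.vars.Finite :=
  (Lit.varsList_finite _).union h.vars_finite

/-! ### T-norms and degrees -/

theorem TNorm.one_op (T : TNorm) (a : Deg) : T.op 1 a = a := by rw [T.comm, T.op_one]

/-- Degrees can only decrease as factors are compounded, so a threshold met by a compound degree is
met by each of its factors. -/
theorem TNorm.op_le_left (T : TNorm) (a b : Deg) : T.op a b ≤ a := by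
  have := T.mono b 1 a unitInterval.le_one'
  rwa [T.one_op, T.comm] at this

theorem TNorm.op_le_right (T : TNorm) (a b : Deg) : T.op a b ≤ b := by
  rw [T.comm]; exact T.op_le_left b a

mutual
theorem Term.degree_self (T : TNorm) (R : Proximity Sym) : ∀ t : Term Sym, t.degree T R t = 1
  | .var x => by simp [Term.degree]
  | .app f ts => by rw [Term.degree, R.refl, Term.degreeList_self T R ts, T.op_one]
theorem Term.degreeList_self (T : TNorm) (R : Proximity Sym) :
    ∀ ts : List (Term Sym), Term.degreeList T R ts ts = 1
  | [] => by simp [Term.degreeList]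
  | t :: ts => by
    rw [Term.degreeList, Term.degree_self T R t, Term.degreeList_self T R ts, T.op_one]
end

mutual
theorem Term.degree_comm (T : TNorm) (R : Proximity Sym) :
    ∀ t s : Term Sym, t.degree T R s = s.degree T R t
  | .var x, .var y => by simp [Term.degree, eq_comm]
  | .var _, .app _ _ => by simp [Term.degree]
  | .app _ _, .var _ => by simp [Term.degree]
  | .app f ts, .app g ss => by
    rw [Term.degree, Term.degree, R.symm, Term.degreeList_comm T R ts ss]
theorem Term.degreeList_comm (T : TNorm) (R : Proximity Sym) :
    ∀ ts ss : List (Term Sym), Term.degreeList T R ts ss = Term.degreeList T R ss ts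
  | [], [] => rfl
  | [], _ :: _ => by simp [Term.degreeList]
  | _ :: _, [] => by simp [Term.degreeList]
  | t :: ts, s :: ss => by
    rw [Term.degreeList, Term.degreeList, Term.degree_comm T R t s,
      Term.degreeList_comm T R ts ss]
end

/-! ### Weak unification in big-step form -/

/-- A sequence of unification problems. -/
abbrev Problems (Sym : Type*) := List (Term Sym × Term Sym)

/-- The instance of a sequence of unification problems. -/
def Problems.subst (σ : Subst Sym) (E : Problems Sym) : Problems Sym :=
  E.map fun e => (e.1.subst σ, e.2.subst σ)

theorem Problems.subst_id (E : Problems Sym) : E.subst Subst.id = E := by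
  simp [Problems.subst, Term.subst_id]

theorem Problems.subst_comp (σ τ : Subst Sym) (E : Problems Sym) :
    E.subst (σ.comp τ) = Problems.subst τ (E.subst σ) := by
  simp [Problems.subst, Term.subst_comp]

theorem Problems.subst_append (σ : Subst Sym) (E F : Problems Sym) :
    Problems.subst σ (E ++ F) = E.subst σ ++ F.subst σ := by
  simp [Problems.subst]

theorem Problems.subst_zip (σ : Subst Sym) (ts ss : List (Term Sym)) :
    Problems.subst σ (ts.zip ss) = (Term.substList σ ts).zip (Term.substList σ ss) := by
  simp [Problems.subst, Term.substList_eq_map, List.zip_map, Prod.map]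

/-- The compound degree of a sequence of pairs of expressions. -/
noncomputable def Problems.degree (T : TNorm) (R : Proximity Sym) : Problems Sym → Deg
  | [] => 1
  | e :: E => T.op (e.1.degree T R e.2) (Problems.degree T R E)

theorem Problems.degree_zip (T : TNorm) (R : Proximity Sym) :
    ∀ ts ss : List (Term Sym), ts.length = ss.length →
      Problems.degree T R (ts.zip ss) = Term.degreeList T R ts ss
  | [], [], _ => by simp [Problems.degree, Term.degreeList]
  | t :: ts, s :: ss, h => by
    simp only [List.zip_cons_cons, Problems.degree, Term.degreeList]
    rw [Problems.degree_zip T R ts ss (by simpa using h)]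

/-- The weak unification algorithm solves the problems `E` with the computed substitution `σ`. -/
inductive Solves (R : Proximity Sym) (lam : Deg) : Problems Sym → Subst Sym → Prop
  | nil : Solves R lam [] Subst.id
  | decompose (f g : Sym) (ts ss : List (Term Sym)) (E : Problems Sym) (σ : Subst Sym)
      (hlen : ts.length = ss.length) (hR : lam ≤ R.rel f g) (h : Solves R lam (ts.zip ss ++ E) σ) :
      Solves R lam ((.app f ts, .app g ss) :: E) σ
  | trivial (x : ℕ) (E : Problems Sym) (σ : Subst Sym) (h : Solves R lam E σ) :
      Solves R lam ((.var x, .var x) :: E) σ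
  | elimLeft (x : ℕ) (t : Term Sym) (E : Problems Sym) (σ : Subst Sym) (hx : x ∉ t.vars)
      (h : Solves R lam (E.subst (.single x t)) σ) :
      Solves R lam ((.var x, t) :: E) ((Subst.single x t).comp σ)
  | elimRight (x : ℕ) (t : Term Sym) (E : Problems Sym) (σ : Subst Sym) (hx : x ∉ t.vars)
      (h : Solves R lam (E.subst (.single x t)) σ) :
      Solves R lam ((t, .var x) :: E) ((Subst.single x t).comp σ)

section Solves

variable {R : Proximity Sym} {lam : Deg}

/-- The accumulated substitution never influences which step is possible and is only extended on the
right, so an initial `θ` factors out. The next lemma is the converse. -/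
theorem Solves.steps {E : Problems Sym} {σ : Subst Sym} (h : Solves R lam E σ) :
    ∀ θ : Subst Sym, Relation.ReflTransGen (UnifStep R lam) (E, θ) ([], θ.comp σ) := by
  induction h with
  | nil => intro θ; rw [Subst.comp_id]
  | decompose f g ts ss E σ hlen hR _ ih =>
    exact fun θ => (ih θ).head (UnifStep.decompose f g ts ss E θ hlen hR)
  | trivial x E σ _ ih => exact fun θ => (ih θ).head (UnifStep.trivial x E θ)
  | elimLeft x t E σ hx _ ih =>
    intro θ
    rw [← Subst.comp_assoc]
    exact (ih _).head (UnifStep.elimLeft x t E θ hx)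
  | elimRight x t E σ hx _ ih =>
    intro θ
    rw [← Subst.comp_assoc]
    exact (ih _).head (UnifStep.elimRight x t E θ hx)

theorem exists_solves_of_steps {p q : Problems Sym × Subst Sym}
    (h : Relation.ReflTransGen (UnifStep R lam) p q) (hq : q.1 = []) :
    ∃ σ, Solves R lam p.1 σ ∧ q.2 = p.2.comp σ := by
  induction h using Relation.ReflTransGen.head_induction_on with
  | refl => exact ⟨Subst.id, hq ▸ Solves.nil, (Subst.comp_id _).symm⟩
  | head hstep _ ih =>
    obtain ⟨σ, hs, he⟩ := ih
    cases hstep with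
    | decompose f g ts ss E θ hlen hR => exact ⟨σ, .decompose f g ts ss E σ hlen hR hs, he⟩
    | trivial x E θ => exact ⟨σ, .trivial x E σ hs, he⟩
    | elimLeft x t E θ hx =>
      exact ⟨_, .elimLeft x t E σ hx hs, he.trans (Subst.comp_assoc _ _ _)⟩
    | elimRight x t E θ hx =>
      exact ⟨_, .elimRight x t E σ hx hs, he.trans (Subst.comp_assoc _ _ _)⟩

theorem isWmgu_iff_solves {A B : Term Sym} {σ : Subst Sym} :
    IsWmgu R lam A B σ ↔ Solves R lam [(A, B)] σ := by
  constructor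
  · intro h
    obtain ⟨τ, hs, he⟩ := exists_solves_of_steps h rfl
    have : σ = τ := he
    exact this ▸ hs
  · exact fun h => h.steps Subst.id

theorem solves_nil_iff {σ : Subst Sym} : Solves R lam [] σ ↔ σ = Subst.id := by
  constructor
  · intro h; cases h; rfl
  · rintro rfl; exact .nil

theorem solves_app_app_iff {f g : Sym} {ts ss : List (Term Sym)} {σ : Subst Sym} :
    Solves R lam [(.app f ts, .app g ss)] σ ↔
      ts.length = ss.length ∧ lam ≤ R.rel f g ∧ Solves R lam (ts.zip ss) σ := by
  constructor
  · intro h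
    cases h with
    | decompose _ _ _ _ _ _ hlen hR h => exact ⟨hlen, hR, by simpa using h⟩
  · rintro ⟨hlen, hR, h⟩
    exact .decompose f g ts ss [] σ hlen hR (by simpa using h)

/-- Problems are processed from the left, and each binding made in `E` is at once applied to `F`;
when `E` is exhausted, exactly `F.subst σ` remains. -/
theorem Solves.append {E F : Problems Sym} {σ τ : Subst Sym} (hE : Solves R lam E σ)
    (hF : Solves R lam (F.subst σ) τ) : Solves R lam (E ++ F) (σ.comp τ) := by
  induction hE generalizing F with
  | nil => rw [Problems.subst_id] at hF; exact hF
  | decompose f g ts ss E σ hlen hR _ ih =>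
    exact .decompose f g ts ss _ _ hlen hR (by simpa using ih hF)
  | trivial x E σ _ ih => exact .trivial x _ _ (ih hF)
  | elimLeft x t E σ hx _ ih =>
    rw [Subst.comp_assoc]
    refine .elimLeft x t _ _ hx ?_
    refine (Problems.subst_append (.single x t) E F).symm ▸ ih ?_
    rwa [← Problems.subst_comp]
  | elimRight x t E σ hx _ ih =>
    rw [Subst.comp_assoc]
    refine .elimRight x t _ _ hx ?_
    refine (Problems.subst_append (.single x t) E F).symm ▸ ih ?_
    rwa [← Problems.subst_comp]

/-- Cuts a run at the moment when the problems stemming from `E` are used up. The list `D` with an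
equation stands for `E ++ F` so that induction on the run applies. -/
theorem Solves.exists_of_append {D : Problems Sym} {υ : Subst Sym} (h : Solves R lam D υ) :
    ∀ E F : Problems Sym, D = E ++ F → ∃ σ τ, Solves R lam E σ ∧ Solves R lam (F.subst σ) τ ∧
      υ = σ.comp τ := by
  have base : ∀ {F : Problems Sym} {υ : Subst Sym}, Solves R lam F υ →
      ∃ σ τ, Solves R lam [] σ ∧ Solves R lam (F.subst σ) τ ∧ υ = σ.comp τ := fun {F υ} hF =>
    ⟨Subst.id, υ, .nil, by rwa [Problems.subst_id], rfl⟩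
  induction h with
  | nil =>
    intro E F h
    obtain ⟨rfl, rfl⟩ := List.nil_eq_append_iff.1 h
    exact base .nil
  | decompose f g ts ss D σ hlen hR hs ih =>
    intro E F h
    rcases List.cons_eq_append_iff.1 h with ⟨rfl, rfl⟩ | ⟨E', rfl, rfl⟩
    · exact base (.decompose f g ts ss D σ hlen hR hs)
    · obtain ⟨σ₁, σ₂, h₁, h₂, e⟩ := ih (ts.zip ss ++ E') F (by simp)
      exact ⟨σ₁, σ₂, .decompose f g ts ss _ _ hlen hR h₁, h₂, e⟩
  | trivial x D σ hs ih =>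
    intro E F h
    rcases List.cons_eq_append_iff.1 h with ⟨rfl, rfl⟩ | ⟨E', rfl, rfl⟩
    · exact base (.trivial x D σ hs)
    · obtain ⟨σ₁, σ₂, h₁, h₂, e⟩ := ih E' F rfl
      exact ⟨σ₁, σ₂, .trivial x _ _ h₁, h₂, e⟩
  | elimLeft x t D σ hx hs ih =>
    intro E F h
    rcases List.cons_eq_append_iff.1 h with ⟨rfl, rfl⟩ | ⟨E', rfl, rfl⟩
    · exact base (.elimLeft x t D σ hx hs)
    · obtain ⟨σ₁, σ₂, h₁, h₂, e⟩ := ih _ _ (Problems.subst_append _ E' F)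
      exact ⟨_, σ₂, .elimLeft x t _ _ hx h₁, by rwa [Problems.subst_comp],
        by rw [e, Subst.comp_assoc]⟩
  | elimRight x t D σ hx hs ih =>
    intro E F h
    rcases List.cons_eq_append_iff.1 h with ⟨rfl, rfl⟩ | ⟨E', rfl, rfl⟩
    · exact base (.elimRight x t D σ hx hs)
    · obtain ⟨σ₁, σ₂, h₁, h₂, e⟩ := ih _ _ (Problems.subst_append _ E' F)
      exact ⟨_, σ₂, .elimRight x t _ _ hx h₁, by rwa [Problems.subst_comp],
        by rw [e, Subst.comp_assoc]⟩

theorem solves_cons_iff {A B : Term Sym} {E : Problems Sym} {υ : Subst Sym} :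
    Solves R lam ((A, B) :: E) υ ↔
      ∃ σ τ, Solves R lam [(A, B)] σ ∧ Solves R lam (E.subst σ) τ ∧ υ = σ.comp τ := by
  constructor
  · exact fun h => h.exists_of_append [(A, B)] E rfl
  · rintro ⟨σ, τ, h₁, h₂, rfl⟩
    exact h₁.append h₂

/-- The two elimination rules mirror each other, and decomposition is symmetric because `R` is. Both
the bindings chosen and the answer stay the same. -/
theorem Solves.swap {E : Problems Sym} {σ : Subst Sym} (h : Solves R lam E σ) :
    Solves R lam (E.map Prod.swap) σ := by
  induction h with
  | nil => exact .nil
  | decompose f g ts ss E σ hlen hR _ ih =>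
    refine .decompose g f ss ts _ σ hlen.symm (R.symm f g ▸ hR) ?_
    rwa [List.map_append, List.zip_swap] at ih
  | trivial x E σ _ ih => exact .trivial x _ σ ih
  | elimLeft x t E σ hx _ ih =>
    exact .elimRight x t _ σ hx (by simpa [Problems.subst, Function.comp_def] using ih)
  | elimRight x t E σ hx _ ih =>
    exact .elimLeft x t _ σ hx (by simpa [Problems.subst, Function.comp_def] using ih)

theorem solves_zip_comm {ts ss : List (Term Sym)} {σ : Subst Sym} :
    Solves R lam (ts.zip ss) σ ↔ Solves R lam (ss.zip ts) σ := by
  constructor <;> intro h <;> simpa only [List.zip_swap] using h.swap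

/-- Keeps the set of variables in use finite along a derivation, so that fresh ones always exist. -/
theorem Solves.finiteDomain {E : Problems Sym} {σ : Subst Sym} (h : Solves R lam E σ) :
    σ.FiniteDomain := by
  induction h with
  | nil => exact Subst.finiteDomain_id
  | decompose _ _ _ _ _ _ _ _ _ ih => exact ih
  | trivial _ _ _ _ ih => exact ih
  | elimLeft x t _ _ _ _ ih => exact (Subst.finiteDomain_single x t).comp ih
  | elimRight x t _ _ _ _ ih => exact (Subst.finiteDomain_single x t).comp ih

theorem Problems.degree_subst_of_forall (T : TNorm) {E : Problems Sym} {σ : Subst Sym}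
    (h : ∀ e ∈ E, (e.1.subst σ).degree T R (e.2.subst σ) = e.1.degree T R e.2) :
    Problems.degree T R (E.subst σ) = E.degree T R := by
  induction E with
  | nil => rfl
  | cons e E ih =>
    have h' := h e (by simp)
    have := ih fun e he => h e (by simp [he])
    simp only [Problems.subst, List.map_cons, Problems.degree] at this ⊢
    rw [this, h']

/-- Further instantiation of solved problems does not change their degrees, since the two sides
have their variables at the same positions. -/
theorem Solves.degree_subst (T : TNorm) {E : Problems Sym} {σ : Subst Sym}
    (h : Solves R lam E σ) (τ : Subst Sym) :
    ∀ e ∈ E, ((e.1.subst σ).subst τ).degree T R ((e.2.subst σ).subst τ) =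
      (e.1.subst σ).degree T R (e.2.subst σ) := by
  have refl : ∀ {s t : Term Sym} {σ : Subst Sym}, s.subst σ = t.subst σ →
      ((s.subst σ).subst τ).degree T R ((t.subst σ).subst τ) =
        (s.subst σ).degree T R (t.subst σ) := fun h => by
    rw [h, Term.degree_self, Term.degree_self]
  -- As `x` is not in `t`, binding `x` makes the two sides syntactically equal; their degree is then
  -- `1` before and after any instantiation.
  have elim : ∀ (x : ℕ) (t : Term Sym) (σ : Subst Sym), x ∉ t.vars →
      (Term.var x).subst ((Subst.single x t).comp σ) = t.subst ((Subst.single x t).comp σ) :=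
    fun x t σ hx => by
      rw [Term.subst_comp, Term.subst_comp, Term.subst_var_single,
        Term.subst_single_of_notMem x t t hx]
  have tail : ∀ {x : ℕ} {t : Term Sym} {E : Problems Sym} {σ : Subst Sym},
      (∀ e ∈ E.subst (Subst.single x t), ((e.1.subst σ).subst τ).degree T R ((e.2.subst σ).subst τ) =
        (e.1.subst σ).degree T R (e.2.subst σ)) →
      ∀ e ∈ E, ((e.1.subst ((Subst.single x t).comp σ)).subst τ).degree T R
        ((e.2.subst ((Subst.single x t).comp σ)).subst τ) =
        (e.1.subst ((Subst.single x t).comp σ)).degree T R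
          (e.2.subst ((Subst.single x t).comp σ)) := fun ih e he => by
    simp only [Term.subst_comp _ _ e.1, Term.subst_comp _ _ e.2]
    exact ih _ (List.mem_map_of_mem he)
  induction h with
  | nil => simp
  | decompose f g ts ss E σ hlen hR _ ih =>
    refine List.forall_mem_cons.2 ⟨?_, fun e he => ih e (List.mem_append_right _ he)⟩
    -- The argument pairs are among the problems of the induction hypothesis; each keeps its degree,
    -- hence so does their compound.
    have h : Problems.degree T R (Problems.subst τ (Problems.subst σ (ts.zip ss))) =
        Problems.degree T R (Problems.subst σ (ts.zip ss)) := by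
      refine Problems.degree_subst_of_forall T fun e he => ?_
      obtain ⟨e', he', rfl⟩ := List.mem_map.1 he
      exact ih _ (List.mem_append_left _ he')
    simp only [Problems.subst_zip] at h
    rw [Problems.degree_zip, Problems.degree_zip] at h
    · simp only [Term.subst, Term.degree, h]
    all_goals simpa [Term.substList_eq_map] using hlen
  | trivial x E σ _ ih => exact List.forall_mem_cons.2 ⟨refl rfl, ih⟩
  | elimLeft x t E σ hx _ ih =>
    exact List.forall_mem_cons.2 ⟨refl (elim x t σ hx), tail ih⟩
  | elimRight x t E σ hx _ ih =>
    exact List.forall_mem_cons.2 ⟨refl (elim x t σ hx).symm, tail ih⟩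

/-- The degrees of a sequence of problems, solved one after the other, compound to the degree of
the whole sequence. -/
theorem degree_cons_of_solves (T : TNorm) {A B : Term Sym} {E : Problems Sym} {σ : Subst Sym}
    (h : Solves R lam [(A, B)] σ) (τ : Subst Sym) :
    Problems.degree T R (Problems.subst (σ.comp τ) ((A, B) :: E)) =
      T.op ((A.subst σ).degree T R (B.subst σ)) (Problems.degree T R ((E.subst σ).subst τ)) := by
  have := h.degree_subst T τ (A, B) (by simp)
  rw [← Problems.subst_comp, ← this]
  simp [Problems.subst, Problems.degree, Term.subst_comp]

end Solves

/-! ### Expanded states -/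

/-- The goal of the expanded semantics that consists of weak unification problems, followed by a
source goal. -/
def expGoal (E : Problems Sym) (Q : List (Lit Sym)) : List (ExpLit Sym) :=
  E.map (fun e => ExpLit.weq e.1 e.2) ++ Q.map ExpLit.lit

theorem expGoal_nil (Q : List (Lit Sym)) : expGoal [] Q = Q.map ExpLit.lit := rfl

theorem expGoal_cons (A B : Term Sym) (E : Problems Sym) (Q : List (Lit Sym)) :
    expGoal ((A, B) :: E) Q = .weq A B :: expGoal E Q := rfl

theorem expGoal_subst (σ : Subst Sym) (E : Problems Sym) (Q : List (Lit Sym)) :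
    (expGoal E Q).map (ExpLit.subst σ) = expGoal (E.subst σ) (Lit.substList σ Q) := by
  rw [expGoal, List.map_append, map_lit_subst]
  simp [expGoal, Problems.subst, ExpLit.subst]

theorem expGoal_zip (ts ss : List (Term Sym)) (B Q : List (Lit Sym)) :
    List.zipWith ExpLit.weq ss ts ++ (B.map ExpLit.lit ++ Q.map ExpLit.lit) =
      expGoal (ss.zip ts) (B ++ Q) := by
  simp [expGoal, List.zip, List.map_zipWith]

theorem map_lit_injective :
    Function.Injective (List.map (ExpLit.lit : Lit Sym → ExpLit Sym)) :=
  List.map_injective_iff.2 fun _ _ h => ExpLit.lit.inj h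

/-- A source goal has no pending problems: this is why a derivation that ends in one has completed
its last block. -/
theorem map_lit_eq_expGoal_iff {E : Problems Sym} {Q Q' : List (Lit Sym)} :
    Q'.map ExpLit.lit = expGoal E Q ↔ E = [] ∧ Q' = Q := by
  cases E with
  | nil => simp [expGoal_nil, map_lit_injective.eq_iff]
  | cons e E => cases Q' <;> simp [expGoal]

theorem mem_varsList_iff {x : ℕ} {Q : List (Lit Sym)} :
    x ∈ Lit.varsList Q ↔ ∃ L ∈ Q, x ∈ L.vars := by
  induction Q with
  | nil => simp [Lit.varsList]
  | cons L Q ih => simp [Lit.varsList, ih]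

/-- Makes the freshness conditions of the two semantics coincide on source goals. -/
theorem ExpState.vars_map_lit (Q : List (Lit Sym)) (P : ExpProgram Sym) (P' : Program Sym)
    (θ : Subst Sym) (α : Deg) :
    ExpState.vars ⟨Q.map ExpLit.lit, P, θ, α⟩ = HState.vars ⟨Q, P', θ, α⟩ := by
  ext x
  simp [ExpState.vars, HState.vars, mem_varsList_iff, ExpLit.vars]

theorem Program.expand_insert (T : TNorm) (R : Proximity Sym) (lam : Deg) (r : Rule Sym)
    (P : Program Sym) :
    Program.expand T R lam (insert r P) = r.expand T R lam ∪ Program.expand T R lam P := by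
  simp [Program.expand]

/-- The expanded state of a state. -/
def HState.expand (T : TNorm) (R : Proximity Sym) (lam : Deg) (s : HState Sym) : ExpState Sym :=
  ⟨s.goal.map ExpLit.lit, s.prog.expand T R lam, s.subst, s.degree⟩

-- Simulating HWSLD derivations by expanded derivations

section Derivations

variable {T : TNorm} {R : Proximity Sym} {lam : Deg}

theorem ExpSteps.single {W : Set ℕ} {s₁ s₂ : ExpState Sym} (h : ExpStep T R lam W s₁ s₂) :
    ExpSteps T R lam W s₁ s₂ := .head W _ _ _ h (.refl W _)

theorem ExpSteps.trans {W : Set ℕ} {s₁ s₂ s₃ : ExpState Sym} (h : ExpSteps T R lam W s₁ s₂)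
    (h' : ExpSteps T R lam W s₂ s₃) : ExpSteps T R lam W s₁ s₃ := by
  suffices ∀ {W : Set ℕ} {s₁ s₂ : ExpState Sym}, ExpSteps T R lam W s₁ s₂ →
      ∀ s₃, ExpSteps T R lam W s₂ s₃ → ExpSteps T R lam W s₁ s₃ from this h _ h'
  intro W s₁ s₂ h
  -- Concatenation concerns the outer chain only, so nothing is claimed about single steps.
  refine ExpSteps.rec (motive_1 := fun W s₁ s₂ _ => True)
    (motive_2 := fun W s₁ s₂ _ =>
      ∀ s₃, ExpSteps T R lam W s₂ s₃ → ExpSteps T R lam W s₁ s₃) ?_ ?_ ?_ ?_ ?_ ?_ h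
  · intros; exact True.intro
  · intros; exact True.intro
  · intros; exact True.intro
  · intros; exact True.intro
  · exact fun _ _ _ h => h
  · exact fun W _ _ _ h _ _ ih s₃ h' => .head W _ _ _ h (ih s₃ h')

/-- Solvable weak unification problems of a sufficient degree can be removed from a goal. -/
theorem ExpSteps.of_solves {W : Set ℕ} {P : ExpProgram Sym} {E : Problems Sym} {υ : Subst Sym}
    (h : Solves R lam E υ) {Q : List (Lit Sym)} {θ : Subst Sym} {α : Deg}
    (hlam : lam ≤ T.op (Problems.degree T R (E.subst υ)) α) :
    ExpSteps T R lam W ⟨expGoal E Q, P, θ, α⟩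
      ⟨(Lit.substList υ Q).map ExpLit.lit, P, θ.comp υ,
        T.op (Problems.degree T R (E.subst υ)) α⟩ := by
  induction hn : E.length generalizing E υ Q θ α with
  | zero =>
    obtain rfl := List.length_eq_zero_iff.1 hn
    obtain rfl := solves_nil_iff.1 h
    rw [Problems.subst_id, Lit.substList_id, Subst.comp_id, Problems.degree, T.one_op]
    exact .refl _ _
  | succ n ih =>
    obtain ⟨⟨A, B⟩, E, rfl⟩ := List.exists_cons_of_length_eq_add_one hn
    obtain ⟨σ, τ, h₁, h₂, rfl⟩ := solves_cons_iff.1 h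
    have hdeg : T.op (Problems.degree T R (Problems.subst (σ.comp τ) ((A, B) :: E))) α =
        T.op (Problems.degree T R (Problems.subst τ (Problems.subst σ E)))
          (T.op ((A.subst σ).degree T R (B.subst σ)) α) := by
      rw [degree_cons_of_solves T h₁, T.comm ((A.subst σ).degree T R _), T.assoc]
    rw [hdeg] at hlam ⊢
    -- Both thresholds for the first problem follow from the one for the whole sequence.
    have hα := hlam.trans (T.op_le_right _ _)
    have hβ := hα.trans (T.op_le_left _ _)
    rw [expGoal_cons, Lit.substList_comp, ← Subst.comp_assoc]
    refine .head _ _ _ _ (.unify W P A B _ θ σ α _ (isWmgu_iff_solves.2 h₁) rfl hβ hα) ?_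
    rw [expGoal_subst]
    exact ih h₂ hlam (by simpa [Problems.subst] using hn)

theorem degree_app_app (T : TNorm) (R : Proximity Sym) {f g : Sym} {ts ss : List (Term Sym)}
    (hlen : ts.length = ss.length) (σ : Subst Sym) :
    Term.degree T R ((Term.app f ts).subst σ) ((Term.app g ss).subst σ) =
      T.op (R.rel f g) (Problems.degree T R (Problems.subst σ (ss.zip ts))) := by
  rw [Term.subst, Term.subst, Term.degree, Problems.subst_zip, Problems.degree_zip,
    Term.degreeList_comm]
  simpa [Term.substList_eq_map] using hlen.symm

/-- On the left the order of HWSLD, with `T.op ρ β` the degree of head and atom; on the right the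
expanded order, where `T.op δ ρ` is consumed before the degree `β` of the arguments. -/
theorem TNorm.op_rearrange (T : TNorm) (δ ρ β α : Deg) :
    T.op (T.op δ (T.op ρ β)) α = T.op β (T.op (T.op δ ρ) α) := by
  rw [← T.assoc, T.comm (T.op δ ρ) β, T.assoc]

theorem exists_fresh_list {V : Set ℕ} (hV : V.Finite) (n : ℕ) :
    ∃ ys : List ℕ, ys.length = n ∧ ys.Nodup ∧ ∀ y ∈ ys, y ∉ V := by
  obtain ⟨s, hs, hn⟩ := hV.infinite_compl.exists_subset_card_eq n
  exact ⟨s.toList, by simpa using hn, s.nodup_toList, fun y hy => hs (by simpa using hy)⟩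

/-- A resolution step is simulated by unfolding and removal of a degree and of unification
problems. -/
theorem ExpSteps.of_resolve (hpos : 0 < lam) {W : Set ℕ} (hW : W.Finite) {P : Program Sym}
    {r : Rule Sym} {ρ : Equiv.Perm ℕ} {A : Atom Sym} {Q : List (Lit Sym)} {θ σ : Subst Sym}
    (hθ : θ.FiniteDomain) {α : Deg} (hr : r ∈ P)
    (hfresh : Disjoint (r.rename ρ).vars (W ∪ HState.vars ⟨.atom A :: Q, P, θ, α⟩))
    (hσ : IsWmgu R lam (r.rename ρ).head.toTerm A.toTerm σ)
    (hlam : lam ≤ T.op (T.op r.grade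
      (Term.degree T R ((r.rename ρ).head.toTerm.subst σ) (A.toTerm.subst σ))) α) :
    ExpSteps T R lam W (HState.expand T R lam ⟨.atom A :: Q, P, θ, α⟩)
      (HState.expand T R lam ⟨Lit.substList σ ((r.rename ρ).body ++ Q), P, θ.comp σ,
        T.op (T.op r.grade
          (Term.degree T R ((r.rename ρ).head.toTerm.subst σ) (A.toTerm.subst σ))) α⟩) := by
  obtain ⟨q, ss⟩ := A
  have hσ' := isWmgu_iff_solves.1 hσ
  obtain ⟨hlen, hR, hsol⟩ := solves_app_app_iff.1 hσ'
  have hlen' : r.head.args.length = ss.length := by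
    simpa [Rule.rename, Atom.subst, Term.substList_eq_map] using hlen
  have hdeg : Term.degree T R ((r.rename ρ).head.toTerm.subst σ) (Atom.toTerm ⟨q, ss⟩ |>.subst σ) =
      _ := degree_app_app T R hlen σ
  rw [hdeg, T.op_rearrange] at hlam ⊢
  have hα := hlam.trans (T.op_le_right _ _)
  set V := W ∪ HState.vars ⟨.atom ⟨q, ss⟩ :: Q, P, θ, α⟩ with hVdef
  have hV : V.Finite := hW.union (HState.vars_finite _ hθ)
  -- The `ys` are the head variables after renaming; their preimages under `ρ` serve in the expanded
  -- rule itself. Avoiding the image of the rule's variables keeps these preimages out of the rule.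
  obtain ⟨ys, hyn, hynd, hyV⟩ :=
    exists_fresh_list (hV.union ((Rule.vars_finite r).image ρ)) ss.length
  have hmap : (ys.map ρ.symm).map ρ = ys := by simp [Function.comp_def]
  let c : ExpRule Sym :=
    ⟨q, ys.map ρ.symm, T.op r.grade (R.rel r.head.pred q), r.head.args, r.body⟩
  have hc : c ∈ P.expand T R lam := by
    refine Set.mem_biUnion hr ⟨q, ys.map ρ.symm, hR, by simp [hyn, hlen'],
      hynd.map ρ.symm.injective, fun x hx hxr => ?_, rfl⟩
    obtain ⟨y, hy, rfl⟩ := List.mem_map.1 hx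
    exact hyV y hy (Or.inr ⟨_, hxr, by simp⟩)
  have hcvars : (c.rename ρ).vars = {x | x ∈ ys} ∪ (r.rename ρ).vars := by
    simp only [ExpRule.vars, ExpRule.rename, c, hmap, Set.union_assoc]
    rfl
  have hcfresh : Disjoint (c.rename ρ).vars
      (W ∪ ExpState.vars ⟨.lit (.atom ⟨c.pred, ss⟩) :: Q.map ExpLit.lit, P.expand T R lam, θ, α⟩) := by
    have := ExpState.vars_map_lit (.atom ⟨q, ss⟩ :: Q) (P.expand T R lam) P θ α
    rw [List.map_cons] at this
    rw [hcvars, this]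
    refine Disjoint.union_left (Set.disjoint_left.2 fun y hy hyV' => ?_) hfresh
    exact hyV y hy (Or.inl hyV')
  refine .head _ _ _ _ (.unfold W _ c ρ ss _ θ α hc (by simp [ExpRule.rename, c, hyn]) hcfresh) ?_
  refine .head _ _ _ _ (.degree W _ _ θ α _
    (hpos.trans_le (hα.trans (T.op_le_left _ _))) hα) ?_
  rw [expGoal_zip]
  exact ExpSteps.of_solves (solves_zip_comm.1 hsol) hlam

theorem HSteps.expand (hpos : 0 < lam) {W : Set ℕ} {s₁ s₂ : HState Sym}
    (h : HSteps T R lam W s₁ s₂) (hW : W.Finite) (hs : s₁.subst.FiniteDomain) :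
    s₂.subst.FiniteDomain ∧
      ExpSteps T R lam W (s₁.expand T R lam) (s₂.expand T R lam) := by
  refine HSteps.rec
    (motive_1 := fun W s₁ s₂ _ => W.Finite → s₁.subst.FiniteDomain → s₂.subst.FiniteDomain ∧
      ExpSteps T R lam W (s₁.expand T R lam) (s₂.expand T R lam))
    (motive_2 := fun W s₁ s₂ _ => W.Finite → s₁.subst.FiniteDomain → s₂.subst.FiniteDomain ∧
      ExpSteps T R lam W (s₁.expand T R lam) (s₂.expand T R lam)) ?_ ?_ ?_ ?_ h hW hs
  · rintro W P r ρ A Q θ σ α β hr hfresh hσ rfl _ hlam hW hθ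
    exact ⟨Subst.FiniteDomain.comp hθ (isWmgu_iff_solves.1 hσ).finiteDomain,
      .of_resolve hpos hW hθ hr hfresh hσ hlam⟩
  · intro W P H B δ G Q θ σ α α' _ ih hW hθ
    obtain ⟨hσ, hsteps⟩ := ih (hW.union (HState.vars_finite _ hθ)) Subst.finiteDomain_id
    refine ⟨Subst.FiniteDomain.comp hθ hσ, .single ?_⟩
    simp only [HState.expand] at hsteps ⊢
    rw [T.comm α α', ← map_lit_subst]
    rw [Program.expand_insert] at hsteps
    refine .assume W _ H B δ G _ θ σ α α' ?_
    have := ExpState.vars_map_lit (.imp H B δ G :: Q) (P.expand T R lam) P θ α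
    rw [List.map_cons] at this
    rw [this]
    exact hsteps
  · exact fun W s _ hs => ⟨hs, .refl _ _⟩
  · intro W s₁ s₂ s₃ _ _ ih₁ ih₂ hW hs
    obtain ⟨hs₂, h₁₂⟩ := ih₁ hW hs
    obtain ⟨hs₃, h₂₃⟩ := ih₂ hW hs₂
    exact ⟨hs₃, h₁₂.trans h₂₃⟩

-- Reading expanded derivations back as HWSLD derivations

/-- The state that the expanded semantics reaches from a goal with the problems `E` and the source
goal `Q`, once the problems are solved with substitution `υ`. -/
noncomputable def solvedState (T : TNorm) (R : Proximity Sym) (E : Problems Sym)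
    (Q : List (Lit Sym)) (P : Program Sym) (θ : Subst Sym) (α : Deg) (υ : Subst Sym) : HState Sym :=
  ⟨Lit.substList υ Q, P, θ.comp υ, T.op (Problems.degree T R (E.subst υ)) α⟩

theorem solvedState_nil (T : TNorm) (R : Proximity Sym) (Q : List (Lit Sym)) (P : Program Sym)
    (θ : Subst Sym) (α : Deg) : solvedState T R [] Q P θ α Subst.id = ⟨Q, P, θ, α⟩ := by
  rw [solvedState, Problems.subst_id, Lit.substList_id, Subst.comp_id, Problems.degree, T.one_op]

theorem solvedState_cons (T : TNorm) {A B : Term Sym} {E : Problems Sym} {σ : Subst Sym}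
    (h : Solves R lam [(A, B)] σ) (Q : List (Lit Sym)) (P : Program Sym) (θ : Subst Sym) (α : Deg)
    (τ : Subst Sym) :
    solvedState T R ((A, B) :: E) Q P θ α (σ.comp τ) =
      solvedState T R (E.subst σ) (Lit.substList σ Q) P (θ.comp σ)
        (T.op ((A.subst σ).degree T R (B.subst σ)) α) τ := by
  rw [solvedState, solvedState, Lit.substList_comp, Subst.comp_assoc, degree_cons_of_solves T h,
    T.comm ((A.subst σ).degree T R _), T.assoc]

/-- Contracts a block to one resolution step. The head variables `xs` leave no trace in the
resulting state, so only the freshness of the rest of the rule matters. -/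
theorem HStep.of_unfold {W : Set ℕ} {P : Program Sym} {c : ExpRule Sym} {ρ : Equiv.Perm ℕ}
    {ss : List (Term Sym)} {Q : List (Lit Sym)} {θ υ : Subst Sym} {α : Deg}
    (hc : c ∈ P.expand T R lam) (hlen : (c.rename ρ).xs.length = ss.length)
    (hfresh : Disjoint (c.rename ρ).vars (W ∪ HState.vars ⟨.atom ⟨c.pred, ss⟩ :: Q, P, θ, α⟩))
    (hυ : Solves R lam (ss.zip (c.rename ρ).ts) υ)
    (hlam : lam ≤ (solvedState T R (ss.zip (c.rename ρ).ts) ((c.rename ρ).body ++ Q) P θ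
      (T.op c.grade α) υ).degree) :
    HStep T R lam W ⟨.atom ⟨c.pred, ss⟩ :: Q, P, θ, α⟩
      (solvedState T R (ss.zip (c.rename ρ).ts) ((c.rename ρ).body ++ Q) P θ
        (T.op c.grade α) υ) := by
  simp only [Program.expand, Set.mem_iUnion] at hc
  obtain ⟨r, hr, q, xs, hR, hxs, -, -, rfl⟩ := hc
  have hlen' : (Term.substList (.ofPerm ρ) r.head.args).length = ss.length := by
    simpa [ExpRule.rename, Term.substList_eq_map, hxs] using hlen
  have hdeg : Term.degree T R ((r.rename ρ).head.toTerm.subst υ) (Atom.toTerm ⟨q, ss⟩ |>.subst υ) =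
      _ := degree_app_app T R hlen' υ
  have hop := T.op_rearrange r.grade (R.rel r.head.pred q)
    (Problems.degree T R (Problems.subst υ (ss.zip (Term.substList (.ofPerm ρ) r.head.args)))) α
  have hstate : solvedState T R (ss.zip (Term.substList (.ofPerm ρ) r.head.args))
      ((r.rename ρ).body ++ Q) P θ (T.op (T.op r.grade (R.rel r.head.pred q)) α) υ =
      ⟨Lit.substList υ ((r.rename ρ).body ++ Q), P, θ.comp υ, T.op (T.op r.grade
        (Term.degree T R ((r.rename ρ).head.toTerm.subst υ)
          (Atom.toTerm ⟨q, ss⟩ |>.subst υ))) α⟩ := by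
    rw [hdeg]
    exact congrArg (State.mk _ _ _) hop.symm
  have hlam' := hlam.trans_eq (congrArg State.degree hstate)
  refine Eq.subst (motive := HStep T R lam W _) hstate.symm
    (.resolve W P r ρ ⟨q, ss⟩ Q θ υ α _ hr (hfresh.mono_left ?_)
      (isWmgu_iff_solves.2 (solves_app_app_iff.2 ⟨hlen', hR, solves_zip_comm.1 hυ⟩)) rfl
      (hlam'.trans ((T.op_le_left _ _).trans (T.op_le_right _ _))) hlam')
  rintro x (hx | hx)
  · exact Or.inl (Or.inr hx)
  · exact Or.inr hx

/-- A derivation of the expanded semantics from a goal with unification problems, possibly preceded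
by a degree, to a source goal solves the problems first; what remains is an HWSLD derivation. -/
theorem ExpSteps.exists_solves {W : Set ℕ} {s₁ s₂ : ExpState Sym}
    (h : ExpSteps T R lam W s₁ s₂) (P : Program Sym) (Q' : List (Lit Sym)) (θ' : Subst Sym)
    (α' : Deg) (hs₂ : s₂ = HState.expand T R lam ⟨Q', P, θ', α'⟩) (E : Problems Sym)
    (Q : List (Lit Sym)) (θ : Subst Sym) (α : Deg) :
    (s₁ = ⟨expGoal E Q, P.expand T R lam, θ, α⟩ → ∃ υ, Solves R lam E υ ∧
      (lam ≤ α → lam ≤ (solvedState T R E Q P θ α υ).degree) ∧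
      HSteps T R lam W (solvedState T R E Q P θ α υ) ⟨Q', P, θ', α'⟩) ∧
    (∀ β, s₁ = ⟨.deg β :: expGoal E Q, P.expand T R lam, θ, α⟩ → ∃ υ, Solves R lam E υ ∧
      lam ≤ (solvedState T R E Q P θ (T.op β α) υ).degree ∧
      HSteps T R lam W (solvedState T R E Q P θ (T.op β α) υ) ⟨Q', P, θ', α'⟩) := by
  -- `motive_1` retains the step itself, for the case analysis on the head of a chain, and
  -- translates it only when an embedded implication is selected: there alone an induction
  -- hypothesis on a subderivation is needed. Blocks are treated in `motive_2`. The condition `lam ≤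
  -- α` covers `E = []`, where no check takes place and the initial degree is arbitrary.
  refine ExpSteps.rec
    (motive_1 := fun W s₁ s₂ _ => ExpStep T R lam W s₁ s₂ ∧
      ∀ (P : Program Sym) (H : Atom Sym) (B : List (Lit Sym)) (δ : Deg) (G : Lit Sym)
        (Q : List (Lit Sym)) (θ : Subst Sym) (α : Deg),
        s₁ = HState.expand T R lam ⟨.imp H B δ G :: Q, P, θ, α⟩ →
        ∃ (Q₂ : List (Lit Sym)) (θ₂ : Subst Sym) (α₂ : Deg),
          s₂ = HState.expand T R lam ⟨Q₂, P, θ₂, α₂⟩ ∧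
          HStep T R lam W ⟨.imp H B δ G :: Q, P, θ, α⟩ ⟨Q₂, P, θ₂, α₂⟩)
    (motive_2 := fun W s₁ s₂ _ => ∀ (P : Program Sym) (Q' : List (Lit Sym)) (θ' : Subst Sym)
      (α' : Deg) (_ : s₂ = HState.expand T R lam ⟨Q', P, θ', α'⟩) (E : Problems Sym)
      (Q : List (Lit Sym)) (θ : Subst Sym) (α : Deg),
      (s₁ = ⟨expGoal E Q, P.expand T R lam, θ, α⟩ → ∃ υ, Solves R lam E υ ∧
        (lam ≤ α → lam ≤ (solvedState T R E Q P θ α υ).degree) ∧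
        HSteps T R lam W (solvedState T R E Q P θ α υ) ⟨Q', P, θ', α'⟩) ∧
      (∀ β, s₁ = ⟨.deg β :: expGoal E Q, P.expand T R lam, θ, α⟩ → ∃ υ, Solves R lam E υ ∧
        lam ≤ (solvedState T R E Q P θ (T.op β α) υ).degree ∧
        HSteps T R lam W (solvedState T R E Q P θ (T.op β α) υ) ⟨Q', P, θ', α'⟩))
    ?_ ?_ ?_ ?_ ?_ ?_ h P Q' θ' α' hs₂ E Q θ α
  · intro W P Q θ α β hβ hlam
    refine ⟨.degree W P Q θ α β hβ hlam, fun P H B δ G Q θ α e => ?_⟩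
    simp [HState.expand] at e
  · intro W P A B Q θ σ α β hσ hβ hlamβ hlam
    refine ⟨.unify W P A B Q θ σ α β hσ hβ hlamβ hlam, fun P H B δ G Q θ α e => ?_⟩
    simp [HState.expand] at e
  · intro W P c ρ ss Q θ α hc hlen hfresh
    refine ⟨.unfold W P c ρ ss Q θ α hc hlen hfresh, fun P H B δ G Q θ α e => ?_⟩
    simp [HState.expand] at e
  · intro W P' H B δ G Q' θ σ α β hsub ih
    refine ⟨.assume W P' H B δ G Q' θ σ α β hsub, fun P H' B' δ' G' Q θ' α' e => ?_⟩
    simp only [HState.expand, List.map_cons, State.mk.injEq, List.cons.injEq, ExpLit.lit.injEq,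
      Lit.imp.injEq] at e
    obtain ⟨⟨⟨rfl, rfl, rfl, rfl⟩, rfl⟩, rfl, rfl, rfl⟩ := e
    refine ⟨Lit.substList σ Q, θ.comp σ, T.op α β, ?_, ?_⟩
    · rw [map_lit_subst, T.comm]; rfl
    · obtain ⟨υ, hυ, -, hsteps⟩ := (ih (insert ⟨H, B, δ⟩ P) [] σ β
        (by rw [HState.expand, Program.expand_insert]; rfl) [] [G] Subst.id 1).1
        (by rw [Program.expand_insert]; rfl)
      obtain rfl := solves_nil_iff.1 hυ
      rw [solvedState_nil] at hsteps
      refine .assume W P H B δ G Q θ σ α β ?_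
      rwa [← ExpState.vars_map_lit _ (P.expand T R lam), List.map_cons]
  · rintro W s P Q' θ' α' rfl E Q θ α
    refine ⟨fun e => ?_, fun β e => ?_⟩
    · simp only [HState.expand, State.mk.injEq, map_lit_eq_expGoal_iff] at e
      obtain ⟨⟨rfl, rfl⟩, -, rfl, rfl⟩ := e
      refine ⟨Subst.id, .nil, ?_, ?_⟩ <;> rw [solvedState_nil]
      · exact fun h => h
      · exact .refl _ _
    -- A source goal does not start with a degree, so the derivation cannot stop here.
    · cases Q' <;> simp [HState.expand] at e
  · rintro W s₁ s₂ s₃ - hs ⟨hstep, ih₁⟩ ih P Q' θ' α' hs₃ E Q θ α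
    refine ⟨fun e => ?_, fun β e => ?_⟩
    · subst e
      obtain _ | ⟨⟨A, B⟩, E⟩ := E
      · obtain _ | ⟨⟨A⟩ | ⟨H, B, δ, G⟩, Q⟩ := Q
        · cases hstep
        · refine ⟨Subst.id, .nil, ?_, ?_⟩ <;> rw [solvedState_nil]
          · exact fun h => h
          obtain ⟨q, ss⟩ := A
          cases hstep with
          | unfold _ _ c ρ _ _ _ _ hc hlen hfresh =>
            obtain ⟨υ, hυ, hlam, hsteps⟩ :=
              (ih P Q' θ' α' hs₃ (ss.zip (c.rename ρ).ts) ((c.rename ρ).body ++ Q) θ α).2 c.grade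
                (by rw [← expGoal_zip])
            refine .head _ _ _ _ (.of_unfold hc hlen ?_ hυ hlam) hsteps
            rwa [← ExpState.vars_map_lit _ (P.expand T R lam), List.map_cons]
        · refine ⟨Subst.id, .nil, ?_, ?_⟩ <;> rw [solvedState_nil]
          · exact fun h => h
          obtain ⟨Q₂, θ₂, α₂, rfl, hH⟩ := ih₁ P H B δ G Q θ α rfl
          obtain ⟨υ, hυ, -, hsteps⟩ := (ih P Q' θ' α' hs₃ [] Q₂ θ₂ α₂).1 rfl
          obtain rfl := solves_nil_iff.1 hυ
          rw [solvedState_nil] at hsteps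
          exact .head _ _ _ _ hH hsteps
      · cases hstep with
        | unify _ _ _ _ _ _ σ _ β hσ hβ hlamβ hlam =>
          subst hβ
          have hσ' := isWmgu_iff_solves.1 hσ
          obtain ⟨τ, hτ, hdeg, hsteps⟩ := (ih P Q' θ' α' hs₃ (Problems.subst σ E) (Lit.substList σ Q)
            (θ.comp σ) _).1 (by rw [← expGoal_subst]; rfl)
          refine ⟨σ.comp τ, solves_cons_iff.2 ⟨σ, τ, hσ', hτ, rfl⟩, ?_, ?_⟩ <;>
            rw [solvedState_cons T hσ']
          -- The check of this unification step already gives the threshold for the remaining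
          -- problems.
          · exact fun _ => hdeg hlam
          · exact hsteps
    · subst e
      cases hstep with
      | degree _ _ _ _ _ _ hβ hlam =>
        obtain ⟨υ, hυ, hdeg, hsteps⟩ := (ih P Q' θ' α' hs₃ E Q θ _).1 rfl
        exact ⟨υ, hυ, hdeg hlam, hsteps⟩

end Derivations

end BousiProlog

theorem proposition4p3 {Sym : Type*} (T : BousiProlog.TNorm) (R : BousiProlog.Proximity Sym)
    (lam : BousiProlog.Deg) (hlam : 0 < lam) (P : BousiProlog.Program Sym)
    (Q Q' : List (BousiProlog.Lit Sym)) (θ θ' : BousiProlog.Subst Sym)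
    (hθ : θ.FiniteDomain) (α α' : BousiProlog.Deg) :
    BousiProlog.HSteps T R lam ∅ ⟨Q, P, θ, α⟩ ⟨Q', P, θ', α'⟩ ↔
      BousiProlog.ExpSteps T R lam ∅
        ⟨Q.map BousiProlog.ExpLit.lit, P.expand T R lam, θ, α⟩
        ⟨Q'.map BousiProlog.ExpLit.lit, P.expand T R lam, θ', α'⟩ := by
  constructor
  · exact fun h => (h.expand hlam Set.finite_empty hθ).2
  · intro h
    -- With no pending problems the solving substitution is the identity and the solved state is the
    -- initial one.
    obtain ⟨υ, hυ, -, hsteps⟩ := (h.exists_solves P Q' θ' α' rfl [] Q θ α).1 rfl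
    obtain rfl := BousiProlog.solves_nil_iff.1 hυ
    rwa [BousiProlog.solvedState_nil] at hsteps
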